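/- Let $N\ge 1$, let $\mathcal X$ range over real tensors in $\mathbb R^{I_1\times\cdots\times I_N}$, let $X_{(i)}$ denote the mode-$i$ unfolding of $\mathcal X$ (the matrix with $I_i$ rows whose columns are the mode-$i$ fibers), and for a matrix $A$ let $\sigma_1(A)\ge\sigma_2(A)\ge\cdots$ be its singular values (with $\sigma_j(A)=0$ for $j$ beyond the number of rows or of columns), $\|A\|_*=\sum_j\sigma_j(A)$ and $\|A\|_2=\sigma_1(A)$. Put $\|\mathcal X\|_*=\frac1N\sum_{i=1}^N\|X_{(i)}\|_*$ and let $\|\mathcal X\|_F$ be the Frobenius norm. Let $\mathfrak F$ be a linear operator from $\mathbb R^{I_1\times\cdots\times I_N}$ to a real vector space, let $\alpha>0$ be a real number, and let $r_1,\dots,r_N$ be nonnegative integers. Let $\mathcal X^0$ be a tensor of rank $(r_1,\dots,r_N)$ or less, i.e. $\operatorname{rank}(X^0_{(i)})\le r_i$ for $i=1,\dots,N$, and let $b=\mathfrak F(\mathcal X^0)$. Suppose that every nonzero $\mathcal H$ with $\mathfrak F(\mathcal H)=0$ satisfies $$\sum_{i=1}^N\sum_{j=r_i+1}^{I_i}\sigma_j(H_{(i)})\;\ge\;\sum_{i=1}^N\Bigl(1+\frac{\|X^0_{(i)}\|_2}{\alpha}\Bigr)\sum_{j=1}^{r_i}\sigma_j(H_{(i)}).$$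 Then $\mathcal X^0$ is the unique minimizer of the problem $$\min_{\mathcal X}\Bigl\{\|\mathcal X\|_*+\frac1{2\alpha}\|\mathcal X\|_F^2:\ \mathfrak F(\mathcal X)=b\Bigr\}.$$ -/

import Mathlib

noncomputable section

namespace TensorRecovery

/-- The `j`-th largest singular value `σ_j(A)` of a real matrix, counted from `j = 0`; it is `0` for
`j` at least the number of rows or the number of columns of `A`. -/
def sigma {p q : ℕ} (A : Matrix (Fin p) (Fin q) ℝ) (j : ℕ) : ℝ :=
  (Matrix.toEuclideanLin A).singularValues j

/-- The trace norm `‖A‖_*`: the sum of the singular values. -/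
def traceNorm {p q : ℕ} (A : Matrix (Fin p) (Fin q) ℝ) : ℝ :=
  ∑ j ∈ Finset.range (min p q), sigma A j

/-- The spectral norm `‖A‖₂`: the largest singular value. -/
def spectralNorm {p q : ℕ} (A : Matrix (Fin p) (Fin q) ℝ) : ℝ :=
  sigma A 0

/-- Real tensors of order `N` and size `I 0 × ⋯ × I (N - 1)`, with the entrywise Euclidean inner
product; the norm `‖X‖` of this space is the Frobenius norm. -/
abbrev Tensor {N : ℕ} (I : Fin N → ℕ) : Type :=
  EuclideanSpace ℝ ((k : Fin N) → Fin (I k))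

/-- The mode-`n` unfolding of a tensor of order `N + 1`. Rows are indexed by the `n`-th index, and
the entry at `(i_0, …, i_N)` goes to the column `∑_{k ≠ n} i_k * ∏_{m < k, m ≠ n} I_m`
(all indices counted from `0`). -/
def unfold {N : ℕ} {I : Fin (N + 1) → ℕ} (X : Tensor I) (n : Fin (N + 1)) :
    Matrix (Fin (I n)) (Fin (∏ k : Fin N, I (n.succAbove k))) ℝ :=
  Matrix.of fun a c => X (n.insertNth a (finPiFinEquiv.symm c))

/-- The `n`-rank of a tensor: the column rank of its mode-`n` unfolding. -/
def modeRank {N : ℕ} {I : Fin (N + 1) → ℕ} (n : Fin (N + 1)) (X : Tensor I) : ℕ :=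
  (unfold X n).rank

/-- The tensor trace norm of a tensor of order `N + 1`: the average of the trace norms of its
unfoldings. -/
def tensorTraceNorm {N : ℕ} {I : Fin (N + 1) → ℕ} (X : Tensor I) : ℝ :=
  (1 / ((N + 1 : ℕ) : ℝ)) * ∑ i, traceNorm (unfold X i)

/-- The objective `‖X‖_* + (1 / (2 α)) ‖X‖_F ^ 2` of the augmented model. -/
def augObjective {N : ℕ} {I : Fin (N + 1) → ℕ} (α : ℝ) (X : Tensor I) : ℝ :=
  tensorTraceNorm X + 1 / (2 * α) * ‖X‖ ^ 2

/-- `X` solves the augmented model: it minimizes the objective among the tensors with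
`F Y = b`. -/
def IsAugSolution {N : ℕ} {I : Fin (N + 1) → ℕ} {W : Type*} [AddCommGroup W] [Module ℝ W]
    (α : ℝ) (F : Tensor I →ₗ[ℝ] W) (b : W) (X : Tensor I) : Prop :=
  F X = b ∧ ∀ Y : Tensor I, F Y = b → augObjective α X ≤ augObjective α Y

end TensorRecovery

end

/-! Write a feasible point as X₀ + H with F H = 0. Expanding the square gives a cross term ⟪X₀, H⟫ /
α and a term ‖H‖² / (2α). In each mode, with head and tail the sums of σ_j(H₍ᵢ₎) before and from
r_i, the trace norm changes by at least tail minus head (Mirsky, `traceNorm_add_ge`), and the cross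
term is at least -‖X₀₍ᵢ₎‖₂ / α times the head (von Neumann, `neg_le_sum_mul`). Averaged over the
modes, these contributions are nonnegative by hypothesis, and ‖H‖² / (2α) remains as strict growth.

For Mirsky's inequality, consider the dilation of T, the symmetric form 2⟪y, T x⟫ on F × E, with
eigenvalues ±σ_j(T) and zeros. Adding to the dilation of A the negative part of that of A - B gives
an operator S above the dilations of both A and B, of trace ∑ σ_j(A - B). By Courant–Fischer each
eigenvalue of S is bounded below by the corresponding one of either dilation; a suitable choice for
each index, summed, gives the bound (`sum_singularValues_sub_ge`). -/

namespace TensorRecovery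

open Module
open scoped InnerProductSpace

/-! ### Singular value decomposition -/

section SingularValueDecomposition

variable {E F : Type*} [NormedAddCommGroup E] [InnerProductSpace ℝ E] [FiniteDimensional ℝ E]
  [NormedAddCommGroup F] [InnerProductSpace ℝ F] [FiniteDimensional ℝ F]

/-- `u` and `v` are left and right singular vectors of `T`; the left singular vectors at the
singular value `0` are taken to be `0`. -/
structure IsSVD (T : E →ₗ[ℝ] F) {n : ℕ} (u : Fin n → F) (v : OrthonormalBasis (Fin n) ℝ E) :
    Prop where
  map_right : ∀ k, T (v k) = T.singularValues k • u k
  inner_left : ∀ i j, ⟪u i, u j⟫_ℝ = if i = j ∧ T.singularValues i ≠ 0 then 1 else 0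

theorem exists_isSVD (T : E →ₗ[ℝ] F) {n : ℕ} (hn : finrank ℝ E = n) :
    ∃ (u : Fin n → F) (v : OrthonormalBasis (Fin n) ℝ E), IsSVD T u v := by
  let v := T.isSymmetric_adjoint_comp_self.eigenvectorBasis hn
  have hv : ∀ i j, ⟪T (v i), T (v j)⟫_ℝ = if i = j then T.singularValues i ^ 2 else 0 := by
    intro i j
    have h : (T.adjoint ∘ₗ T) (v j) = (T.singularValues j ^ 2) • v j := by
      rw [T.sq_singularValues_fin hn]
      exact T.isSymmetric_adjoint_comp_self.apply_eigenvectorBasis hn j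
    rw [← LinearMap.adjoint_inner_right, ← LinearMap.comp_apply, h, real_inner_smul_right,
      v.inner_eq_ite]
    split_ifs with hij <;> simp [hij]
  -- Since 0⁻¹ = 0, left vectors at the singular value 0 vanish.
  refine ⟨fun k => (T.singularValues k)⁻¹ • T (v k), v, fun k => ?_, fun i j => ?_⟩
  · by_cases h : T.singularValues k = 0
    · have := hv k k
      rw [h] at this
      simpa [h] using this
    · rw [smul_smul, mul_inv_cancel₀ h, one_smul]
  · rw [real_inner_smul_left, real_inner_smul_right, hv]
    by_cases hij : i = j
    · subst hij
      by_cases h : T.singularValues i = 0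
      · simp [h]
      · simp only [h, if_true, ne_eq, not_false_eq_true, and_self]
        field_simp
    · simp [hij]

namespace IsSVD

variable {T : E →ₗ[ℝ] F} {n : ℕ} {u : Fin n → F} {v : OrthonormalBasis (Fin n) ℝ E}

theorem left_eq_zero (h : IsSVD T u v) {k : Fin n} (hk : T.singularValues k = 0) : u k = 0 := by
  have := h.inner_left k k
  simpa [hk] using this

theorem norm_sq_sum_smul_left (h : IsSVD T u v) (c : Fin n → ℝ) :
    ‖∑ k, c k • u k‖ ^ 2 = ∑ k, c k ^ 2 * (if T.singularValues k ≠ 0 then 1 else 0) := by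
  rw [← real_inner_self_eq_norm_sq, sum_inner]
  refine Finset.sum_congr rfl fun i _ => ?_
  rw [inner_sum, Finset.sum_eq_single i]
  · rw [real_inner_smul_left, real_inner_smul_right, h.inner_left]
    simp only [true_and]
    ring
  · intro j _ hj
    rw [real_inner_smul_left, real_inner_smul_right, h.inner_left, if_neg fun hh => hj hh.1.symm]
    simp
  · simp

/-- Bessel's inequality for the left singular vectors. -/
theorem sum_inner_left_sq_le (h : IsSVD T u v) (y : F) : ∑ k, ⟪u k, y⟫_ℝ ^ 2 ≤ ‖y‖ ^ 2 := by
  have hz := h.norm_sq_sum_smul_left fun k => ⟪u k, y⟫_ℝ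
  have hz' : ∑ k, ⟪u k, y⟫_ℝ ^ 2 * (if T.singularValues k ≠ 0 then (1 : ℝ) else 0) =
      ∑ k, ⟪u k, y⟫_ℝ ^ 2 := by
    refine Finset.sum_congr rfl fun k _ => ?_
    split_ifs with hk
    · ring
    · rw [h.left_eq_zero (not_not.mp hk)]
      simp
  have hy : ⟪y, ∑ k, ⟪u k, y⟫_ℝ • u k⟫_ℝ = ∑ k, ⟪u k, y⟫_ℝ ^ 2 := by
    rw [inner_sum]
    refine Finset.sum_congr rfl fun k _ => ?_
    rw [real_inner_smul_right, real_inner_comm, sq]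
  have := norm_sub_sq_real y (∑ k, ⟪u k, y⟫_ℝ • u k)
  have h0 := sq_nonneg ‖y - ∑ k, ⟪u k, y⟫_ℝ • u k‖
  rw [hz, hz', hy] at this
  linarith

theorem norm_left_sq (h : IsSVD T u v) (k : Fin n) :
    T.singularValues k * ‖u k‖ ^ 2 = T.singularValues k := by
  rw [← real_inner_self_eq_norm_sq, h.inner_left]
  split_ifs with hk
  · ring
  · simp only [true_and, not_not] at hk
    simp [hk]

theorem inner_map (h : IsSVD T u v) (y : F) (x : E) :
    ⟪y, T x⟫_ℝ = ∑ k : Fin n, T.singularValues k * (⟪u k, y⟫_ℝ * ⟪v k, x⟫_ℝ) := by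
  conv_lhs => rw [← v.sum_repr' x]
  rw [map_sum, inner_sum]
  refine Finset.sum_congr rfl fun k _ => ?_
  rw [map_smul, h.map_right, real_inner_smul_right, real_inner_smul_right,
    real_inner_comm (u k) y]
  ring

/-- On the vectors `(y, x)` whose first `j` singular coordinates agree, the form `⟪y, T x⟫` is
bounded below in terms of the `j`-th singular value. -/
theorem neg_le_inner_map (h : IsSVD T u v) {j : ℕ} (y : F) (x : E)
    (hyx : ∀ k : Fin n, (k : ℕ) < j → ⟪u k, y⟫_ℝ = ⟪v k, x⟫_ℝ) :
    -(T.singularValues j) * (‖y‖ ^ 2 + ‖x‖ ^ 2) ≤ 2 * ⟪y, T x⟫_ℝ := by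
  have hs := T.singularValues_nonneg j
  have hx : ∑ k, ⟪v k, x⟫_ℝ ^ 2 = ‖x‖ ^ 2 := v.sum_sq_inner_right x
  have hy := h.sum_inner_left_sq_le y
  have key : ∑ k, -(T.singularValues j) * (⟪u k, y⟫_ℝ ^ 2 + ⟪v k, x⟫_ℝ ^ 2) ≤
      ∑ k : Fin n, 2 * (T.singularValues k * (⟪u k, y⟫_ℝ * ⟪v k, x⟫_ℝ)) := by
    refine Finset.sum_le_sum fun k _ => ?_
    -- For k < j the right side is a nonnegative multiple of a square; otherwise use 2ab ≥ -(a² +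
    -- b²) and σ_k ≤ σ_j.
    by_cases hk : (k : ℕ) < j
    · rw [hyx k hk]
      have := T.singularValues_nonneg k
      nlinarith [mul_nonneg this (sq_nonneg ⟪v k, x⟫_ℝ), mul_nonneg hs (sq_nonneg ⟪v k, x⟫_ℝ)]
    · have h1 := T.singularValues_antitone (not_lt.mp hk)
      have h2 := T.singularValues_nonneg k
      nlinarith [mul_nonneg h2 (sq_nonneg (⟪u k, y⟫_ℝ + ⟪v k, x⟫_ℝ)),
        mul_nonneg (sub_nonneg.mpr h1) (add_nonneg (sq_nonneg ⟪u k, y⟫_ℝ) (sq_nonneg ⟪v k, x⟫_ℝ))]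
  rw [← Finset.mul_sum, ← Finset.mul_sum, Finset.sum_add_distrib, hx, ← h.inner_map] at key
  nlinarith

/-- On the vectors `(U x, x)`, where `U` maps right to left singular vectors and the singular
coordinates of `x` after the `j`-th vanish, the form `⟪y, T x⟫` is bounded below. -/
theorem le_inner_map (h : IsSVD T u v) {j : ℕ} (x : E)
    (hx : ∀ k : Fin n, j < k → ⟪v k, x⟫_ℝ = 0) :
    T.singularValues j * (‖∑ k, ⟪v k, x⟫_ℝ • u k‖ ^ 2 + ‖x‖ ^ 2) ≤
      2 * ⟪∑ k, ⟪v k, x⟫_ℝ • u k, T x⟫_ℝ := by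
  have hs := T.singularValues_nonneg j
  have hxs : ∑ k, ⟪v k, x⟫_ℝ ^ 2 = ‖x‖ ^ 2 := v.sum_sq_inner_right x
  have hU : ‖∑ k, ⟪v k, x⟫_ℝ • u k‖ ^ 2 ≤ ‖x‖ ^ 2 := by
    rw [h.norm_sq_sum_smul_left, ← hxs]
    refine Finset.sum_le_sum fun k _ => ?_
    split_ifs <;> nlinarith [sq_nonneg ⟪v k, x⟫_ℝ]
  have hform : ⟪∑ k, ⟪v k, x⟫_ℝ • u k, T x⟫_ℝ =
      ∑ k : Fin n, T.singularValues k * ⟪v k, x⟫_ℝ ^ 2 := by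
    rw [sum_inner]
    refine Finset.sum_congr rfl fun k _ => ?_
    rw [real_inner_smul_left, h.inner_map, Finset.sum_eq_single k]
    · rw [real_inner_self_eq_norm_sq]
      linear_combination ⟪v k, x⟫_ℝ ^ 2 * h.norm_left_sq k
    · intro i _ hi
      rw [h.inner_left, if_neg fun hh => hi hh.1]
      simp
    · simp
  have key : T.singularValues j * ‖x‖ ^ 2 ≤ ∑ k : Fin n, T.singularValues k * ⟪v k, x⟫_ℝ ^ 2 := by
    rw [← hxs, Finset.mul_sum]
    refine Finset.sum_le_sum fun k _ => ?_
    by_cases hk : j < k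
    · simp [hx k hk]
    · exact mul_le_mul_of_nonneg_right (T.singularValues_antitone (not_lt.mp hk)) (sq_nonneg _)
  rw [hform]
  nlinarith

end IsSVD

end SingularValueDecomposition

/-! ### Courant–Fischer bound -/

/-- A lower bound for an eigenvalue of a symmetric operator in the manner of Courant and Fischer:
the form is bounded below on a subspace, given as the image under an injective map of a subspace
cut out by `card κ` equations. -/
theorem le_eigenvalues_of_le_inner {G G' κ : Type*} [NormedAddCommGroup G] [InnerProductSpace ℝ G]
    [FiniteDimensional ℝ G] [AddCommGroup G'] [Module ℝ G'] [FiniteDimensional ℝ G'] [Fintype κ]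
    {S : G →ₗ[ℝ] G} (hS : S.IsSymmetric) {d : ℕ} (hd : finrank ℝ G = d) (j : Fin d)
    (L : G' →ₗ[ℝ] G) (hL : Function.Injective L) (φ : κ → G' →ₗ[ℝ] ℝ)
    (hcard : Fintype.card κ + j < finrank ℝ G') {c : ℝ}
    (hc : ∀ x, (∀ k, φ k x = 0) → c * ‖L x‖ ^ 2 ≤ ⟪L x, S (L x)⟫_ℝ) :
    c ≤ hS.eigenvalues hd j := by
  let b := hS.eigenvectorBasis hd
  -- By dimension count some x ≠ 0 satisfies the equations with L x orthogonal to the first j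
  -- eigenvectors.
  let f : G' →ₗ[ℝ] (κ → ℝ) × (Fin j → ℝ) := (LinearMap.pi φ).prod
    (LinearMap.pi fun i => (innerₛₗ ℝ (b ⟨i, i.2.trans j.2⟩)) ∘ₗ L)
  have hf : LinearMap.ker f ≠ ⊥ := by
    apply LinearMap.ker_ne_bot_of_finrank_lt
    simpa using hcard
  obtain ⟨x, hx, hx0⟩ := Submodule.exists_mem_ne_zero_of_ne_bot hf
  have hx' := Prod.ext_iff.mp (LinearMap.mem_ker.mp hx)
  have h1 := hc x fun k => congrFun hx'.1 k
  have h2 : ∀ i : Fin d, i < j → ⟪b i, L x⟫_ℝ = 0 := fun i hi => congrFun hx'.2 ⟨i, hi⟩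
  have hLx : 0 < ‖L x‖ ^ 2 := by
    have : L x ≠ 0 := fun h => hx0 (hL (by simpa using h))
    positivity
  have h3 : ⟪L x, S (L x)⟫_ℝ ≤ hS.eigenvalues hd j * ‖L x‖ ^ 2 := by
    rw [← b.sum_inner_mul_inner, ← b.sum_sq_inner_right, Finset.mul_sum]
    refine Finset.sum_le_sum fun i _ => ?_
    have : ⟪b i, S (L x)⟫_ℝ = hS.eigenvalues hd i * ⟪b i, L x⟫_ℝ := by
      rw [← b.repr_apply_apply, ← b.repr_apply_apply]
      exact hS.eigenvectorBasis_apply_self_apply hd (L x) i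
    rw [this, real_inner_comm]
    by_cases hi : i < j
    · simp [h2 i hi]
    · have := hS.eigenvalues_antitone hd (not_lt.mp hi)
      nlinarith [mul_le_mul_of_nonneg_right this (sq_nonneg ⟪b i, L x⟫_ℝ)]
  exact le_of_mul_le_mul_right (h1.trans h3) hLx

/-! ### Dilations and the inequalities of Mirsky and von Neumann -/

section Dilation

variable {E F : Type*} [NormedAddCommGroup E] [InnerProductSpace ℝ E] [FiniteDimensional ℝ E]
  [NormedAddCommGroup F] [InnerProductSpace ℝ F] [FiniteDimensional ℝ F]

/-- The weighted Gram operator `z ↦ ∑ k, c k • ⟪f k, z⟫ • f k`. -/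
noncomputable def gramOperator {G κ : Type*} [NormedAddCommGroup G] [InnerProductSpace ℝ G]
    [Fintype κ] (c : κ → ℝ) (f : κ → G) : G →ₗ[ℝ] G :=
  ∑ k, c k • (InnerProductSpace.rankOne ℝ (f k) (f k)).toLinearMap

theorem inner_gramOperator {G κ : Type*} [NormedAddCommGroup G] [InnerProductSpace ℝ G]
    [Fintype κ] (c : κ → ℝ) (f : κ → G) (w z : G) :
    ⟪w, gramOperator c f z⟫_ℝ = ∑ k, c k * (⟪f k, w⟫_ℝ * ⟪f k, z⟫_ℝ) := by
  simp only [gramOperator, LinearMap.sum_apply, inner_sum]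
  refine Finset.sum_congr rfl fun k _ => ?_
  simp only [LinearMap.smul_apply, ContinuousLinearMap.coe_coe, InnerProductSpace.rankOne_apply,
    real_inner_smul_right, real_inner_comm w]
  ring

theorem isSymmetric_gramOperator {G κ : Type*} [NormedAddCommGroup G] [InnerProductSpace ℝ G]
    [Fintype κ] (c : κ → ℝ) (f : κ → G) : (gramOperator c f).IsSymmetric := by
  intro w z
  rw [real_inner_comm, inner_gramOperator, inner_gramOperator]
  exact Finset.sum_congr rfl fun k _ => by ring

theorem trace_gramOperator {G κ : Type*} [NormedAddCommGroup G] [InnerProductSpace ℝ G]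
    [FiniteDimensional ℝ G] [Fintype κ] (c : κ → ℝ) (f : κ → G) :
    (gramOperator c f).trace ℝ G = ∑ k, c k * ‖f k‖ ^ 2 := by
  simp only [gramOperator, map_sum, map_smul, InnerProductSpace.trace_rankOne,
    real_inner_self_eq_norm_sq, smul_eq_mul]

/-- A symmetric operator of trace `∑ k, σ_k(A - B)` whose form dominates those of the
self-adjoint dilations of `A` and of `B`. -/
theorem exists_symmetric_dilation (A B : E →ₗ[ℝ] F) :
    ∃ S : WithLp 2 (F × E) →ₗ[ℝ] WithLp 2 (F × E), S.IsSymmetric ∧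
      S.trace ℝ _ = ∑ k : Fin (finrank ℝ E), (A - B).singularValues k ∧
      (∀ z, 2 * ⟪z.fst, A z.snd⟫_ℝ ≤ ⟪z, S z⟫_ℝ) ∧
      ∀ z, 2 * ⟪z.fst, B z.snd⟫_ℝ ≤ ⟪z, S z⟫_ℝ := by
  obtain ⟨u, v, h⟩ := exists_isSVD A rfl
  obtain ⟨u', v', h'⟩ := exists_isSVD (A - B) rfl
  -- P - Q is the dilation of A, of trace zero; R is the negative part of the dilation of A - B.
  let P : WithLp 2 (F × E) →ₗ[ℝ] WithLp 2 (F × E) :=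
    gramOperator (fun k : Fin (finrank ℝ E) => A.singularValues k / 2)
      fun k => WithLp.toLp 2 (u k, v k)
  let Q : WithLp 2 (F × E) →ₗ[ℝ] WithLp 2 (F × E) :=
    gramOperator (fun k : Fin (finrank ℝ E) => A.singularValues k / 2)
      fun k => WithLp.toLp 2 (u k, -v k)
  let R : WithLp 2 (F × E) →ₗ[ℝ] WithLp 2 (F × E) :=
    gramOperator (fun k : Fin (finrank ℝ E) => (A - B).singularValues k / 2)
      fun k => WithLp.toLp 2 (u' k, -v' k)
  have hform : ∀ z, ⟪z, (P - Q + R) z⟫_ℝ = 2 * ⟪z.fst, A z.snd⟫_ℝ +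
      ∑ k : Fin (finrank ℝ E), (A - B).singularValues k / 2 *
        (⟪u' k, z.fst⟫_ℝ - ⟪v' k, z.snd⟫_ℝ) ^ 2 := by
    intro z
    rw [LinearMap.add_apply, LinearMap.sub_apply, inner_add_right, inner_sub_right,
      inner_gramOperator, inner_gramOperator, inner_gramOperator, h.inner_map, Finset.mul_sum,
      ← Finset.sum_sub_distrib]
    congr 1
    · refine Finset.sum_congr rfl fun k _ => ?_
      simp only [WithLp.prod_inner_apply, inner_neg_left, WithLp.ofLp_fst, WithLp.ofLp_snd]
      ring
    · refine Finset.sum_congr rfl fun k _ => ?_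
      simp only [WithLp.prod_inner_apply, inner_neg_left, WithLp.ofLp_fst, WithLp.ofLp_snd]
      ring
  refine ⟨P - Q + R, ?_, ?_, fun z => ?_, fun z => ?_⟩
  · exact ((isSymmetric_gramOperator _ _).sub (isSymmetric_gramOperator _ _)).add
      (isSymmetric_gramOperator _ _)
  · rw [map_add, map_sub, trace_gramOperator, trace_gramOperator, trace_gramOperator]
    simp only [WithLp.prod_norm_sq_eq_of_L2, WithLp.toLp_fst, WithLp.toLp_snd, norm_neg, sub_self,
      zero_add]
    refine Finset.sum_congr rfl fun k _ => ?_
    rw [v'.norm_eq_one]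
    linear_combination (1 / 2 : ℝ) * h'.norm_left_sq k
  · rw [hform]
    have : 0 ≤ ∑ k : Fin (finrank ℝ E), (A - B).singularValues k / 2 *
        (⟪u' k, z.fst⟫_ℝ - ⟪v' k, z.snd⟫_ℝ) ^ 2 :=
      Finset.sum_nonneg fun k _ =>
        mul_nonneg (div_nonneg (LinearMap.singularValues_nonneg _ _) zero_le_two) (sq_nonneg _)
    linarith
  · rw [hform]
    have h1 : ⟪z.fst, A z.snd⟫_ℝ = ⟪z.fst, B z.snd⟫_ℝ + ⟪z.fst, (A - B) z.snd⟫_ℝ := by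
      rw [LinearMap.sub_apply, inner_sub_right]
      ring
    have h2 : 0 ≤ 2 * ⟪z.fst, (A - B) z.snd⟫_ℝ +
        ∑ k : Fin (finrank ℝ E), (A - B).singularValues k / 2 *
          (⟪u' k, z.fst⟫_ℝ - ⟪v' k, z.snd⟫_ℝ) ^ 2 := by
      rw [h'.inner_map, Finset.mul_sum, ← Finset.sum_add_distrib]
      refine Finset.sum_nonneg fun k _ => ?_
      have := mul_nonneg ((A - B).singularValues_nonneg k)
        (sq_nonneg (⟪u' k, z.fst⟫_ℝ + ⟪v' k, z.snd⟫_ℝ))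
      nlinarith
    linarith

/-- If the form of `S` dominates that of the dilation of `B`, then the `j`-th largest eigenvalue
of `S` is at least the `j`-th largest singular value of `B`. -/
theorem singularValues_le_eigenvalues {B : E →ₗ[ℝ] F}
    {S : WithLp 2 (F × E) →ₗ[ℝ] WithLp 2 (F × E)} (hS : S.IsSymmetric)
    (hB : ∀ z, 2 * ⟪z.fst, B z.snd⟫_ℝ ≤ ⟪z, S z⟫_ℝ) {d : ℕ}
    (hd : finrank ℝ (WithLp 2 (F × E)) = d) (j : Fin d) (hj : (j : ℕ) < finrank ℝ E) :
    B.singularValues j ≤ hS.eigenvalues hd j := by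
  obtain ⟨u, v, h⟩ := exists_isSVD B rfl
  let L : E →ₗ[ℝ] WithLp 2 (F × E) := (WithLp.linearEquiv 2 ℝ (F × E)).symm.toLinearMap ∘ₗ
    (∑ k, (innerₛₗ ℝ (v k)).smulRight (u k)).prod LinearMap.id
  have hL : ∀ x, L x = WithLp.toLp 2 (∑ k, ⟪v k, x⟫_ℝ • u k, x) := by
    intro x
    simp [L]
  refine le_eigenvalues_of_le_inner hS hd j L (fun x y hxy => ?_)
    (fun k : {k : Fin (finrank ℝ E) // (j : ℕ) < k} => innerₛₗ ℝ (v k)) ?_ fun x hx => ?_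
  · rw [hL, hL] at hxy
    exact congrArg (fun z => z.snd) hxy
  · have : Fintype.card {k : Fin (finrank ℝ E) // (j : ℕ) < k} = finrank ℝ E - 1 - j := by
      rw [Fintype.card_subtype, ← Fin.card_Ioi ⟨(j : ℕ), hj⟩]
      congr 1
      ext k
      simp [Fin.lt_def]
    omega
  · refine le_trans ?_ (hB _)
    rw [hL, WithLp.prod_norm_sq_eq_of_L2]
    exact h.le_inner_map x fun k hk => hx ⟨k, hk⟩

/-- If the form of `S` dominates that of the dilation of `B`, then the `j`-th smallest eigenvalue
of `S` is at least minus the `j`-th largest singular value of `B`. -/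
theorem neg_singularValues_le_eigenvalues {B : E →ₗ[ℝ] F}
    {S : WithLp 2 (F × E) →ₗ[ℝ] WithLp 2 (F × E)} (hS : S.IsSymmetric)
    (hB : ∀ z, 2 * ⟪z.fst, B z.snd⟫_ℝ ≤ ⟪z, S z⟫_ℝ) {d : ℕ}
    (hd : finrank ℝ (WithLp 2 (F × E)) = d) (i : Fin d) {j : ℕ} (hij : (i : ℕ) + j < d) :
    -(B.singularValues j) ≤ hS.eigenvalues hd i := by
  obtain ⟨u, v, h⟩ := exists_isSVD B rfl
  refine le_eigenvalues_of_le_inner hS hd i LinearMap.id Function.injective_id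
    (fun k : {k : Fin (finrank ℝ E) // (k : ℕ) < j} =>
      innerₛₗ ℝ (WithLp.toLp 2 (u k, -v k) : WithLp 2 (F × E))) ?_ fun z hz => ?_
  · have : Fintype.card {k : Fin (finrank ℝ E) // (k : ℕ) < j} ≤ Fintype.card (Fin j) :=
      Fintype.card_le_of_injective (fun k => ⟨k.1, k.2⟩) fun a b hab => by
        ext
        simpa using hab
    rw [Fintype.card_fin] at this
    omega
  · refine le_trans ?_ (hB _)
    rw [WithLp.prod_norm_sq_eq_of_L2]
    refine h.neg_le_inner_map _ _ fun k hk => ?_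
    have := hz ⟨k, hk⟩
    simp only [innerₛₗ_apply_apply, WithLp.prod_inner_apply, inner_neg_left] at this
    exact add_neg_eq_zero.mp this

/-- A case of Mirsky's inequality: if `A` has rank `r`, then
`∑ σ_j(A) + ∑_{j ≥ r} σ_j(B) - ∑_{j < r} σ_j(B) ≤ ∑ σ_j(A - B)`. -/
theorem sum_singularValues_sub_ge (A B : E →ₗ[ℝ] F) :
    ∑ j ∈ Finset.range (finrank ℝ A.range), A.singularValues j +
        ∑ j ∈ Finset.Ico (finrank ℝ A.range) (finrank ℝ E), B.singularValues j -
        ∑ j ∈ Finset.range (finrank ℝ A.range), B.singularValues j ≤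
      ∑ j ∈ Finset.range (finrank ℝ E), (A - B).singularValues j := by
  obtain ⟨S, hS, htr, hA, hB⟩ := exists_symmetric_dilation A B
  have hrE : finrank ℝ A.range ≤ finrank ℝ E := A.finrank_range_le
  have hrF : finrank ℝ A.range ≤ finrank ℝ F := Submodule.finrank_le _
  have hr0 : A.singularValues (finrank ℝ A.range) = 0 := A.singularValues_finrank_range_self
  set r := finrank ℝ A.range
  set q := finrank ℝ E
  obtain ⟨m, hm⟩ := Nat.exists_eq_add_of_le hrF
  have hd : finrank ℝ (WithLp 2 (F × E)) = q + m + r := by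
    rw [(WithLp.linearEquiv 2 ℝ (F × E)).finrank_eq, finrank_prod, hm]
    ring
  have hsum := hS.trace_eq_sum_eigenvalues hd
  rw [htr, Fin.sum_univ_eq_sum_range (fun k => (A - B).singularValues k)] at hsum
  -- Of the q + m + r eigenvalues, the first r are compared with σ_j(A), those up to q with σ_j(B),
  -- the next m with -σ_r(A) = 0, the last r with -σ_j(B) in reverse order.
  let l : ℕ → ℝ := fun j => if h : j < q + m + r then hS.eigenvalues hd ⟨j, h⟩ else 0
  have hl : ∑ i, hS.eigenvalues hd i = ∑ j ∈ Finset.range (q + m + r), l j := by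
    rw [← Fin.sum_univ_eq_sum_range]
    exact Finset.sum_congr rfl fun i _ => by simp [l]
  have h1 : ∑ j ∈ Finset.range r, A.singularValues j ≤ ∑ j ∈ Finset.range r, l j := by
    refine Finset.sum_le_sum fun j hj => ?_
    rw [Finset.mem_range] at hj
    have hjd : j < q + m + r := by omega
    simp only [l, hjd, dif_pos]
    exact singularValues_le_eigenvalues hS hA hd ⟨j, hjd⟩ (hj.trans_le hrE)
  have h2 : ∑ j ∈ Finset.Ico r q, B.singularValues j ≤ ∑ j ∈ Finset.Ico r q, l j := by
    refine Finset.sum_le_sum fun j hj => ?_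
    rw [Finset.mem_Ico] at hj
    have hjd : j < q + m + r := by omega
    simp only [l, hjd, dif_pos]
    exact singularValues_le_eigenvalues hS hB hd ⟨j, hjd⟩ hj.2
  have h3 : 0 ≤ ∑ j ∈ Finset.range m, l (q + j) := by
    refine Finset.sum_nonneg fun j hj => ?_
    rw [Finset.mem_range] at hj
    have hjd : q + j < q + m + r := by omega
    simp only [l, hjd, dif_pos]
    have := neg_singularValues_le_eigenvalues hS hA hd ⟨q + j, hjd⟩ (j := r) (by simp; omega)
    rwa [hr0, neg_zero] at this
  have h4 : -∑ j ∈ Finset.range r, B.singularValues j ≤ ∑ j ∈ Finset.range r, l (q + m + j) := by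
    rw [← Finset.sum_range_reflect fun j => l (q + m + j), ← Finset.sum_neg_distrib]
    refine Finset.sum_le_sum fun j hj => ?_
    rw [Finset.mem_range] at hj
    have hjd : q + m + (r - 1 - j) < q + m + r := by omega
    simp only [l, hjd, dif_pos]
    exact neg_singularValues_le_eigenvalues hS hB hd ⟨_, hjd⟩ (by simp; omega)
  rw [hl, Finset.sum_range_add, Finset.sum_range_add,
    ← Finset.sum_range_add_sum_Ico l hrE] at hsum
  simp only [RCLike.ofReal_real_eq_id, id_eq] at hsum
  linarith

/-- A case of the inequality of von Neumann. -/
theorem sum_inner_map_le (A B : E →ₗ[ℝ] F) {n : ℕ} (b : OrthonormalBasis (Fin n) ℝ E) {r : ℕ}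
    (hr : finrank ℝ A.range ≤ r) :
    ∑ k, ⟪A (b k), B (b k)⟫_ℝ ≤
      A.singularValues 0 * ∑ j ∈ Finset.range r, B.singularValues j := by
  obtain ⟨u, v, h⟩ := exists_isSVD A rfl
  obtain ⟨u', v', h'⟩ := exists_isSVD B rfl
  have hA0 : ∀ i, r ≤ i → A.singularValues i = 0 := fun i hi =>
    A.singularValues_eq_zero_iff_le_finrank_range.mpr (hr.trans hi)
  have hbasis : ∑ k, ⟪A (b k), B (b k)⟫_ℝ = ∑ i, ⟪A (v i), B (v i)⟫_ℝ := by
    have := (A.adjoint ∘ₗ B).trace_eq_sum_inner b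
    rw [(A.adjoint ∘ₗ B).trace_eq_sum_inner v] at this
    simpa [LinearMap.adjoint_inner_right] using this.symm
  let I := Finset.univ.filter fun i : Fin (finrank ℝ E) => (i : ℕ) < r
  -- Weights with 0 ≤ w k ≤ 1 and total at most r, so ∑ σ_k(B) w k is at most the sum of the r
  -- largest σ_k(B).
  let w : Fin (finrank ℝ E) → ℝ := fun k => ∑ i ∈ I, |⟪u' k, u i⟫_ℝ * ⟪v' k, v i⟫_ℝ|
  have hamgm : ∀ a c : ℝ, |a * c| ≤ (a ^ 2 + c ^ 2) / 2 := fun a c => by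
    rw [abs_le]
    constructor <;> nlinarith [sq_nonneg (a + c), sq_nonneg (a - c)]
  have hu1 : ∀ {T : E →ₗ[ℝ] F} {u v} (_ : IsSVD T (n := finrank ℝ E) u v) (k), ‖u k‖ ^ 2 ≤ 1 := by
    intro T u v hT k
    rw [← real_inner_self_eq_norm_sq, hT.inner_left]
    split_ifs <;> norm_num
  have hw0 : ∀ k, 0 ≤ w k := fun k => Finset.sum_nonneg fun i _ => abs_nonneg _
  have hw1 : ∀ k, w k ≤ 1 := by
    intro k
    calc w k ≤ ∑ i ∈ I, (⟪u' k, u i⟫_ℝ ^ 2 + ⟪v' k, v i⟫_ℝ ^ 2) / 2 :=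
          Finset.sum_le_sum fun i _ => hamgm _ _
      _ ≤ ∑ i, (⟪u' k, u i⟫_ℝ ^ 2 + ⟪v' k, v i⟫_ℝ ^ 2) / 2 :=
          Finset.sum_le_sum_of_subset_of_nonneg (Finset.filter_subset _ _)
            fun i _ _ => by positivity
      _ ≤ 1 := by
        rw [← Finset.sum_div, Finset.sum_add_distrib, v.sum_sq_inner_left, v'.norm_eq_one]
        have := h.sum_inner_left_sq_le (u' k)
        simp only [real_inner_comm (u' k)] at this
        linarith [hu1 h' k]
  have hwr : ∑ k, w k ≤ r := by
    calc ∑ k, w k = ∑ i ∈ I, ∑ k, |⟪u' k, u i⟫_ℝ * ⟪v' k, v i⟫_ℝ| := Finset.sum_comm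
      _ ≤ ∑ i ∈ I, 1 := by
        refine Finset.sum_le_sum fun i _ => ?_
        refine (Finset.sum_le_sum fun k _ => hamgm _ _).trans ?_
        rw [← Finset.sum_div, Finset.sum_add_distrib, v'.sum_sq_inner_right, v.norm_eq_one]
        linarith [h'.sum_inner_left_sq_le (u i), hu1 h i]
      _ ≤ r := by
        rw [Finset.sum_const, nsmul_eq_mul, mul_one, Nat.cast_le]
        calc I.card ≤ (Finset.range r).card :=
              Finset.card_le_card_of_injOn (fun i => (i : ℕ)) (fun i hi => by simpa [I] using hi)
                Fin.val_injective.injOn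
          _ = r := Finset.card_range r
  have hterm : ∀ i ∈ I, ⟪A (v i), B (v i)⟫_ℝ ≤ A.singularValues 0 *
      ∑ k : Fin (finrank ℝ E), B.singularValues k * |⟪u' k, u i⟫_ℝ * ⟪v' k, v i⟫_ℝ| := by
    intro i _
    rw [h.map_right, real_inner_smul_left, h'.inner_map]
    calc A.singularValues i * ∑ k : Fin (finrank ℝ E),
          B.singularValues k * (⟪u' k, u i⟫_ℝ * ⟪v' k, v i⟫_ℝ)
        ≤ A.singularValues i * ∑ k : Fin (finrank ℝ E),
          B.singularValues k * |⟪u' k, u i⟫_ℝ * ⟪v' k, v i⟫_ℝ| :=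
          mul_le_mul_of_nonneg_left (Finset.sum_le_sum fun k _ =>
            mul_le_mul_of_nonneg_left (le_abs_self _) (B.singularValues_nonneg _))
            (A.singularValues_nonneg _)
      _ ≤ _ := mul_le_mul_of_nonneg_right (A.singularValues_antitone (Nat.zero_le _))
          (Finset.sum_nonneg fun k _ => mul_nonneg (B.singularValues_nonneg _) (abs_nonneg _))
  have hI : ∑ i, ⟪A (v i), B (v i)⟫_ℝ = ∑ i ∈ I, ⟪A (v i), B (v i)⟫_ℝ := by
    refine (Finset.sum_subset (Finset.filter_subset _ _) fun i _ hi => ?_).symm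
    have : r ≤ i := by simpa [I] using hi
    rw [h.map_right, hA0 i this, zero_smul, inner_zero_left]
  have hmain : ∑ i, ⟪A (v i), B (v i)⟫_ℝ ≤
      A.singularValues 0 * ∑ k : Fin (finrank ℝ E), B.singularValues k * w k := by
    rw [hI]
    refine (Finset.sum_le_sum hterm).trans_eq ?_
    rw [← Finset.mul_sum, Finset.sum_comm]
    simp only [w, Finset.mul_sum]
  have hrearr : ∑ k : Fin (finrank ℝ E), B.singularValues k * w k ≤
      ∑ j ∈ Finset.range r, B.singularValues j := by
    have hβ := B.singularValues_nonneg r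
    -- Shifting by σ_r(B) makes terms nonnegative before index r and nonpositive from it on; the
    -- shift is repaid by ∑ w k ≤ r.
    have h1 : ∑ k : Fin (finrank ℝ E), (B.singularValues k - B.singularValues r) * w k ≤
        ∑ j ∈ Finset.range r, (B.singularValues j - B.singularValues r) := by
      calc ∑ k : Fin (finrank ℝ E), (B.singularValues k - B.singularValues r) * w k
          ≤ ∑ k : Fin (finrank ℝ E),
            if (k : ℕ) < r then B.singularValues k - B.singularValues r else 0 := by
            refine Finset.sum_le_sum fun k _ => ?_
            split_ifs with hk
            · exact mul_le_of_le_one_right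
                (sub_nonneg.mpr (B.singularValues_antitone hk.le)) (hw1 k)
            · exact mul_nonpos_of_nonpos_of_nonneg
                (sub_nonpos.mpr (B.singularValues_antitone (not_lt.mp hk))) (hw0 k)
        _ = ∑ j ∈ (Finset.range (finrank ℝ E)).filter (· < r),
              (B.singularValues j - B.singularValues r) := by
            rw [Finset.sum_filter, ← Fin.sum_univ_eq_sum_range
              (fun k => if k < r then B.singularValues k - B.singularValues r else 0)]
        _ ≤ _ := by
            refine Finset.sum_le_sum_of_subset_of_nonneg (fun j hj => ?_) fun j hj _ => ?_
            · exact Finset.mem_range.mpr (Finset.mem_filter.mp hj).2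
            · exact sub_nonneg.mpr (B.singularValues_antitone (Finset.mem_range.mp hj).le)
    simp only [sub_mul, Finset.sum_sub_distrib, ← Finset.mul_sum, Finset.sum_const,
      Finset.card_range, nsmul_eq_mul] at h1
    nlinarith [mul_le_mul_of_nonneg_left hwr hβ]
  rw [hbasis]
  exact hmain.trans (mul_le_mul_of_nonneg_left hrearr (A.singularValues_nonneg 0))

end Dilation

/-! ### Transfer to matrices -/

section Matrices

variable {p q : ℕ}

theorem sigma_nonneg (A : Matrix (Fin p) (Fin q) ℝ) (j : ℕ) : 0 ≤ sigma A j :=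
  LinearMap.singularValues_nonneg _ _

theorem sigma_neg (A : Matrix (Fin p) (Fin q) ℝ) : sigma (-A) = sigma A := by
  have h : ∀ {S T : EuclideanSpace ℝ (Fin q) →ₗ[ℝ] EuclideanSpace ℝ (Fin p)},
      S.adjoint ∘ₗ S = T.adjoint ∘ₗ T → S.singularValues = T.singularValues := by
    intro S T hST
    unfold LinearMap.singularValues
    congr!
  funext j
  unfold sigma
  rw [h (T := Matrix.toEuclideanLin A)]
  ext
  simp

theorem finrank_range_toEuclideanLin (A : Matrix (Fin p) (Fin q) ℝ) :
    finrank ℝ (Matrix.toEuclideanLin A).range = A.rank := by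
  rw [Matrix.toEuclideanLin, Matrix.toLpLin_eq_toLin]
  exact (A.rank_eq_finrank_range_toLin _ _).symm

theorem sigma_eq_zero_iff {A : Matrix (Fin p) (Fin q) ℝ} {j : ℕ} :
    sigma A j = 0 ↔ A.rank ≤ j := by
  rw [← finrank_range_toEuclideanLin]
  exact LinearMap.singularValues_eq_zero_iff_le_finrank_range _

theorem sum_range_sigma_eq {A : Matrix (Fin p) (Fin q) ℝ} {m : ℕ} (hm : A.rank ≤ m) :
    ∑ j ∈ Finset.range m, sigma A j = ∑ j ∈ Finset.range A.rank, sigma A j := by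
  refine (Finset.sum_subset (Finset.range_subset_range.mpr hm) fun j _ hj => ?_).symm
  exact sigma_eq_zero_iff.mpr (not_lt.mp fun h => hj (Finset.mem_range.mpr h))

theorem rank_le_min (A : Matrix (Fin p) (Fin q) ℝ) : A.rank ≤ min p q :=
  le_min A.rank_le_height A.rank_le_width

theorem traceNorm_eq_sum_range {A : Matrix (Fin p) (Fin q) ℝ} {m : ℕ} (hm : A.rank ≤ m) :
    traceNorm A = ∑ j ∈ Finset.range m, sigma A j := by
  rw [traceNorm, sum_range_sigma_eq (rank_le_min A), sum_range_sigma_eq hm]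

/-- Mirsky's inequality for A and -B. Replacing the rank by a larger r only lowers the left side,
and singular values beyond the matrix size vanish, so either dimension can end the tail. -/
theorem traceNorm_add_ge (A B : Matrix (Fin p) (Fin q) ℝ) {r : ℕ} (hr : A.rank ≤ r) :
    traceNorm A + ∑ j ∈ Finset.Ico r p, sigma B j - ∑ j ∈ Finset.range r, sigma B j ≤
      traceNorm (A + B) := by
  have h := sum_singularValues_sub_ge (Matrix.toEuclideanLin A) (Matrix.toEuclideanLin (-B))
  rw [← map_sub, sub_neg_eq_add, finrank_euclideanSpace_fin, finrank_range_toEuclideanLin] at h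
  change ∑ j ∈ Finset.range A.rank, sigma A j + ∑ j ∈ Finset.Ico A.rank q, sigma (-B) j -
    ∑ j ∈ Finset.range A.rank, sigma (-B) j ≤ ∑ j ∈ Finset.range q, sigma (A + B) j at h
  rw [sigma_neg] at h
  rw [traceNorm_eq_sum_range le_rfl, traceNorm_eq_sum_range (A + B).rank_le_width]
  have h1 : ∑ j ∈ Finset.range A.rank, sigma B j ≤ ∑ j ∈ Finset.range r, sigma B j :=
    Finset.sum_le_sum_of_subset_of_nonneg (Finset.range_subset_range.mpr hr)
      fun j _ _ => sigma_nonneg B j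
  have h2 : ∑ j ∈ Finset.Ico r p, sigma B j ≤ ∑ j ∈ Finset.Ico A.rank q, sigma B j := by
    rw [← Finset.sum_filter_of_ne (p := fun j => j < q) fun j _ hj => ?_]
    · refine Finset.sum_le_sum_of_subset_of_nonneg (fun j hj => ?_) fun j _ _ => sigma_nonneg B j
      simp only [Finset.mem_filter, Finset.mem_Ico] at hj ⊢
      exact ⟨hr.trans hj.1.1, hj.2⟩
    · by_contra hjq
      exact hj (sigma_eq_zero_iff.mpr (B.rank_le_width.trans (not_lt.mp hjq)))
  linarith

theorem neg_le_sum_mul (A B : Matrix (Fin p) (Fin q) ℝ) {r : ℕ} (hr : A.rank ≤ r) :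
    -(spectralNorm A * ∑ j ∈ Finset.range r, sigma B j) ≤ ∑ a, ∑ c, A a c * B a c := by
  have h := sum_inner_map_le (Matrix.toEuclideanLin A) (Matrix.toEuclideanLin (-B))
    (EuclideanSpace.basisFun (Fin q) ℝ) (r := r) (by rwa [finrank_range_toEuclideanLin])
  change _ ≤ spectralNorm A * ∑ j ∈ Finset.range r, sigma (-B) j at h
  rw [sigma_neg] at h
  have h1 : ∑ k, ⟪Matrix.toEuclideanLin A (EuclideanSpace.basisFun (Fin q) ℝ k),
      Matrix.toEuclideanLin (-B) (EuclideanSpace.basisFun (Fin q) ℝ k)⟫_ℝ =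
      -∑ a, ∑ c, A a c * B a c := by
    rw [Finset.sum_comm, ← Finset.sum_neg_distrib]
    refine Finset.sum_congr rfl fun c _ => ?_
    simp [PiLp.inner_apply, Matrix.toLpLin_apply, mul_comm]
  linarith

end Matrices

/-! ### Growth of the tensor objective -/

section Tensors

variable {N : ℕ} {I : Fin (N + 1) → ℕ}

theorem unfold_add (X Y : Tensor I) (n : Fin (N + 1)) :
    unfold (X + Y) n = unfold X n + unfold Y n := rfl

theorem inner_eq_sum_unfold (X Y : Tensor I) (n : Fin (N + 1)) :
    ⟪X, Y⟫_ℝ = ∑ a, ∑ c, unfold X n a c * unfold Y n a c := by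
  rw [PiLp.inner_apply, ← (Fin.insertNthEquiv (fun k => Fin (I k)) n).sum_comp,
    Fintype.sum_prod_type]
  refine Finset.sum_congr rfl fun a _ => ?_
  rw [← finPiFinEquiv.symm.sum_comp]
  refine Finset.sum_congr rfl fun c _ => ?_
  simp [unfold, mul_comm, Fin.insertNthEquiv]

/-- The growth of the objective of the augmented model at a tensor of low `n`-rank. -/
theorem augObjective_add_ge {α : ℝ} (hα : 0 < α) {r : Fin (N + 1) → ℕ} {X : Tensor I}
    (hr : ∀ i, modeRank i X ≤ r i) (H : Tensor I) :
    augObjective α X + 1 / (2 * α) * ‖H‖ ^ 2 + 1 / ((N + 1 : ℕ) : ℝ) *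
        (∑ i, ∑ j ∈ Finset.Ico (r i) (I i), sigma (unfold H i) j -
          ∑ i, (1 + spectralNorm (unfold X i) / α) *
            ∑ j ∈ Finset.range (r i), sigma (unfold H i) j) ≤
      augObjective α (X + H) := by
  have hN : (0 : ℝ) < ((N + 1 : ℕ) : ℝ) := by positivity
  -- Every unfolding preserves the inner product, so the cross term can be shared equally among the
  -- modes.
  have hinner : ⟪X, H⟫_ℝ = 1 / ((N + 1 : ℕ) : ℝ) * ∑ _i : Fin (N + 1), ⟪X, H⟫_ℝ := by
    rw [Finset.sum_const, Finset.card_univ, Fintype.card_fin, nsmul_eq_mul]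
    field_simp
  have hmode : ∑ i, traceNorm (unfold X i) +
      (∑ i, ∑ j ∈ Finset.Ico (r i) (I i), sigma (unfold H i) j -
        ∑ i, (1 + spectralNorm (unfold X i) / α) *
          ∑ j ∈ Finset.range (r i), sigma (unfold H i) j) ≤
      ∑ i, traceNorm (unfold (X + H) i) + 1 / α * ∑ _i : Fin (N + 1), ⟪X, H⟫_ℝ := by
    rw [Finset.mul_sum, ← Finset.sum_sub_distrib, ← Finset.sum_add_distrib,
      ← Finset.sum_add_distrib]
    refine Finset.sum_le_sum fun i _ => ?_
    have h1 := traceNorm_add_ge (unfold X i) (unfold H i) (hr i)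
    have h2 := mul_le_mul_of_nonneg_left (neg_le_sum_mul (unfold X i) (unfold H i) (hr i))
      (one_div_pos.mpr hα).le
    rw [← inner_eq_sum_unfold] at h2
    rw [unfold_add]
    linear_combination h1 + h2
  have h := mul_le_mul_of_nonneg_left hmode (one_div_pos.mpr hN).le
  unfold augObjective tensorTraceNorm
  rw [norm_add_sq_real]
  have hα' : 1 / (2 * α) * (2 * ⟪X, H⟫_ℝ) =
      1 / ((N + 1 : ℕ) : ℝ) * (1 / α * ∑ _i : Fin (N + 1), ⟪X, H⟫_ℝ) := by
    rw [mul_left_comm (1 / ((N + 1 : ℕ) : ℝ)), ← hinner]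
    field_simp
  linear_combination h - hα'

end Tensors

end TensorRecovery

/-! ### Exact recovery -/

open TensorRecovery in
theorem theorem6 {N : ℕ} (I : Fin (N + 1) → ℕ) {W : Type*} [AddCommGroup W] [Module ℝ W]
    (F : Tensor I →ₗ[ℝ] W) (r : Fin (N + 1) → ℕ) (α : ℝ) (hα : 0 < α)
    (X₀ : Tensor I) (b : W) (hb : F X₀ = b)
    (hr : ∀ i, modeRank i X₀ ≤ r i)
    (hNSP : ∀ H : Tensor I, F H = 0 → H ≠ 0 →
      ∑ i, ∑ j ∈ Finset.Ico (r i) (I i), sigma (unfold H i) j ≥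
        ∑ i, (1 + spectralNorm (unfold X₀ i) / α) *
          ∑ j ∈ Finset.range (r i), sigma (unfold H i) j) :
    IsAugSolution α F b X₀ ∧ ∀ X : Tensor I, IsAugSolution α F b X → X = X₀ := by
  have hlt : ∀ Y : Tensor I, F Y = b → Y ≠ X₀ → augObjective α X₀ < augObjective α Y := by
    intro Y hY hne
    have hH : Y - X₀ ≠ 0 := sub_ne_zero.mpr hne
    have h1 := augObjective_add_ge hα hr (Y - X₀)
    have h2 := hNSP (Y - X₀) (by rw [map_sub, hY, hb, sub_self]) hH
    have h3 := mul_nonneg (one_div_nonneg.mpr (Nat.cast_nonneg (α := ℝ) (N + 1)))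
      (sub_nonneg.mpr h2)
    -- Strictness comes from the quadratic term alone, so a non-strict null space condition
    -- suffices.
    have h4 : 0 < 1 / (2 * α) * ‖Y - X₀‖ ^ 2 := by positivity
    rw [add_sub_cancel] at h1
    linarith
  refine ⟨⟨hb, fun Y hY => ?_⟩, fun X hX => ?_⟩
  · by_cases h : Y = X₀
    · rw [h]
    · exact (hlt Y hY h).le
  · by_contra h
    exact (hlt X hX.1 h).not_ge (hX.2 X₀ hb)
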